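/- Let $d\ge 0$, $n\in\{3,4\}$ and $m_1,\dots,m_n>0$. A solution of the Newtonian $n$-body problem in $\mathbb{R}^d$ is a motion $X_1,\dots,X_n:I\to\mathbb{R}^d$ on an open interval $I\subseteq\mathbb{R}$ without collisions ($X_i(t)\ne X_j(t)$ for all $i\neq j$ and $t\in I$) that is twice differentiable and satisfies $$\ddot X_i=\sum_{j\ne i}\frac{m_j}{r_{ij}^3}\,(X_j-X_i),\qquad i=1,\dots,n,\qquad r_{ij}=|X_i-X_j|.$$ A solution is a relative equilibrium if all $\binom n2$ mutual distances $r_{ij}(t)$ are constant on $I$, and it is hinged if all but one of the mutual distances are constant on $I$ and the remaining one is not. Theorem. For every $d$ and all positive masses, the three- and four-body problems in $\mathbb{R}^d$ are unhinged, that is, they have no hinged solutions. In other words: for $n=3$, every solution on which two of the three mutual distances are constant is a relative equilibrium; for $n=4$, every solution on which five of the six mutual distances are constant is a relative equilibrium. -/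

import Mathlib

namespace NBody

/-- Newtonian acceleration of the `i`-th body (gravitational constant `1`) in the configuration `x`
of `n` bodies with masses `m`. -/
noncomputable def acceleration {n d : ℕ} (m : Fin n → ℝ)
    (x : Fin n → EuclideanSpace ℝ (Fin d)) (i : Fin n) : EuclideanSpace ℝ (Fin d) :=
  ∑ j ∈ Finset.univ.erase i, (m j / dist (x i) (x j) ^ 3) • (x j - x i)

/-- `(X, V)` is a (collision-free) solution of the `n`-body problem in `ℝ^d` with masses `m` on the
open time interval `I`, which may be all of `ℝ`. -/
structure IsSolution {n d : ℕ} (m : Fin n → ℝ) (I : Set ℝ)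
    (X V : ℝ → Fin n → EuclideanSpace ℝ (Fin d)) : Prop where
  isOpen : IsOpen I
  ordConnected : I.OrdConnected
  collisionFree : ∀ t ∈ I, ∀ i j, i ≠ j → X t i ≠ X t j
  velocity : ∀ t ∈ I, ∀ i, HasDerivAt (fun s => X s i) (V t i) t
  newton : ∀ t ∈ I, ∀ i, HasDerivAt (fun s => V s i) (acceleration m (X t) i) t

/-- The `n.choose 2` pairs `(i, j)` with `i < j`, indexing the mutual distances. -/
def pairs (n : ℕ) : Finset (Fin n × Fin n) :=
  Finset.univ.filter fun p => p.1 < p.2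

/-- The mutual distance between the two bodies of the pair `p` is constant on `I`. -/
def ConstantDistance {n d : ℕ} (I : Set ℝ) (X : ℝ → Fin n → EuclideanSpace ℝ (Fin d))
    (p : Fin n × Fin n) : Prop :=
  ∃ c : ℝ, ∀ t ∈ I, dist (X t p.1) (X t p.2) = c

/-- All mutual distances are constant. -/
def IsRelativeEquilibrium {n d : ℕ} (I : Set ℝ)
    (X : ℝ → Fin n → EuclideanSpace ℝ (Fin d)) : Prop :=
  ∀ p ∈ pairs n, ConstantDistance I X p

/-- All but one of the mutual distances are constant and the last one is not. -/
def IsHinged {n d : ℕ} (I : Set ℝ) (X : ℝ → Fin n → EuclideanSpace ℝ (Fin d)) : Prop :=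
  ∃ p ∈ pairs n, ¬ ConstantDistance I X p ∧ ∀ q ∈ pairs n, q ≠ p → ConstantDistance I X q

/-- The `n`-body problem in `ℝ^d` has no hinged solutions, whatever the positive masses. -/
def Unhinged (n d : ℕ) : Prop :=
  ∀ (m : Fin n → ℝ), (∀ i, 0 < m i) →
    ∀ (I : Set ℝ) (X V : ℝ → Fin n → EuclideanSpace ℝ (Fin d)),
      IsSolution m I X V → ¬ IsHinged I X

/-- Every solution of the `n`-body problem in `ℝ^d` with positive masses on which (at least) `k` of
the mutual distances are constant is a relative equilibrium. -/
def RigidWith (n d k : ℕ) : Prop :=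
  ∀ (m : Fin n → ℝ), (∀ i, 0 < m i) →
    ∀ (I : Set ℝ) (X V : ℝ → Fin n → EuclideanSpace ℝ (Fin d)), IsSolution m I X V →
      ∀ S ⊆ pairs n, S.card = k → (∀ p ∈ S, ConstantDistance I X p) →
        IsRelativeEquilibrium I X

end NBody

namespace NBody

section Relations

open Polynomial

theorem eval_zero_of_infinite_roots {T : Set ℝ} (hT : T.Infinite) (f : ℝ[X])
    (hf : ∀ x ∈ T, f.eval x = 0) : f.eval 0 = 0 := by
  have : f = 0 := Polynomial.eq_zero_of_infinite_isRoot f (hT.mono fun x hx => hf x hx)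
  simp [this]

/-- The relations between the velocity products of three bodies of which only the distance `x`
between the last two varies cannot hold for infinitely many `x`. -/
theorem not_infinite_of_three_body_relations {s₁ s₂ e : ℝ} {T : Set ℝ} (hT : T.Infinite)
    (h : ∀ x ∈ T, 0 < x ∧ ∃ u, (s₂ * x ^ 3 - 1) * u = -(2 * s₂ * x ^ 5 + x ^ 2 + 3 * e) ∧
      (s₁ * x ^ 3 - 1) * (4 * x ^ 2 - u) = -(2 * s₁ * x ^ 5 + x ^ 2 - 3 * e)) : False := by
  have key := eval_zero_of_infinite_roots hT
    (4 * (C s₁ * X ^ 3 - 1) * (C s₂ * X ^ 3 - 1) + (C s₁ * X ^ 3 - 1) * (2 * C s₂ * X ^ 3 + 1)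
      + (C s₂ * X ^ 3 - 1) * (2 * C s₁ * X ^ 3 + 1) + 3 * C e * (C s₁ - C s₂) * X) ?_
  · norm_num at key
  · intro x hx
    obtain ⟨hx0, u, h1, h2⟩ := h x hx
    simp only [eval_add, eval_sub, eval_mul, eval_pow, eval_C, eval_X, eval_one, eval_ofNat]
    refine mul_left_cancel₀ (pow_ne_zero 2 hx0.ne') ?_
    linear_combination (s₂ * x ^ 3 - 1) * h2 + (s₁ * x ^ 3 - 1) * h1

/-- The linear relations between the normalized velocity products of four bodies of which only the
distance `x` between the last two varies; `s`, `s13`, … are the inverse cubes of the constant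
distances, `e₁ = r₁₃² - r₁₄²` and `e₂ = r₂₃² - r₂₄²`. -/
structure HingeRelations (m₁ m₂ m₃ m₄ s s13 s14 s23 s24 e₁ e₂ x y z u v : ℝ) : Prop where
  pos : 0 < x
  pair13 : m₄ * ((s14 * x ^ 3 - 1) * u) =
    -(m₄ * (2 * s14 * x ^ 5 + x ^ 2 + 3 * e₁)) + m₂ * (s - s23) * y
  pair14 : m₃ * ((s13 * x ^ 3 - 1) * (4 * x ^ 2 - u)) =
    -(m₃ * (2 * s13 * x ^ 5 + x ^ 2 - 3 * e₁)) + m₂ * (s - s24) * z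
  pair23 : m₄ * ((s24 * x ^ 3 - 1) * v) =
    -(m₄ * (2 * s24 * x ^ 5 + x ^ 2 + 3 * e₂)) - m₁ * (s - s13) * y
  pair24 : m₃ * ((s23 * x ^ 3 - 1) * (4 * x ^ 2 - v)) =
    -(m₃ * (2 * s23 * x ^ 5 + x ^ 2 - 3 * e₂)) - m₁ * (s - s14) * z
  skew : y - z = x ^ 3 * (v - u)
  pair12 : m₃ * (s13 - s23) * y + m₄ * (s14 - s24) * z = 0

namespace HingeRelations

variable {m₁ m₂ m₃ m₄ s s13 s14 s23 s24 e₁ e₂ x y z u v : ℝ}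

theorem swap (h : HingeRelations m₁ m₂ m₃ m₄ s s13 s14 s23 s24 e₁ e₂ x y z u v) :
    HingeRelations m₂ m₁ m₃ m₄ s s23 s24 s13 s14 e₂ e₁ x (-y) (-z) v u where
  pos := h.pos
  pair13 := by linear_combination h.pair23
  pair14 := by linear_combination h.pair24
  pair23 := by linear_combination h.pair13
  pair24 := by linear_combination h.pair14
  skew := by linear_combination -h.skew
  pair12 := by linear_combination h.pair12

theorem wing_sum (h : HingeRelations m₁ m₂ m₃ m₄ s s13 s14 s23 s24 e₁ e₂ x y z u v) :
    m₃ * m₄ * ((s14 - s13) * x ^ 3 * u + x ^ 2 * ((6 * s13 + 2 * s14) * x ^ 3 - 2)) =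
      m₂ * (m₃ * (s - s23) * y + m₄ * (s - s24) * z) := by
  linear_combination m₃ * h.pair13 + m₄ * h.pair14

theorem total_sum (h : HingeRelations m₁ m₂ m₃ m₄ s s13 s14 s23 s24 e₁ e₂ x y z u v)
    (h₃ : m₃ ≠ 0) (h₄ : m₄ ≠ 0) :
    m₁ * ((s14 - s13) * x ^ 3 * u + x ^ 2 * ((6 * s13 + 2 * s14) * x ^ 3 - 2)) +
      m₂ * ((s24 - s23) * x ^ 3 * v + x ^ 2 * ((6 * s23 + 2 * s24) * x ^ 3 - 2)) = 0 := by
  apply mul_left_cancel₀ (mul_ne_zero h₃ h₄)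
  linear_combination m₁ * h.wing_sum + m₂ * h.swap.wing_sum + m₁ * m₂ * h.pair12

/-- Letting `x → 0` in the compatibility condition of the relations. -/
theorem balance {T : Set ℝ} (hT : T.Infinite) (h₁ : 0 < m₁) (h₂ : 0 < m₂) (h₃ : 0 < m₃)
    (h₄ : 0 < m₄) (h : ∀ x ∈ T, ∃ y z u v,
      HingeRelations m₁ m₂ m₃ m₄ s s13 s14 s23 s24 e₁ e₂ x y z u v) :
    m₃ * (s - s23) + m₄ * (s - s24) = 0 := by
  have key := eval_zero_of_infinite_roots hT
    ((C (m₂ * (m₃ * (s - s23) + m₄ * (s - s24))) * (C s14 * X ^ 3 - 1) * (C s24 * X ^ 3 - 1) +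
      X ^ 3 * (C (m₂ * (s - s24)) * ((C s14 * X ^ 3 - 1) * C (m₁ * (s - s13)) +
          (C s24 * X ^ 3 - 1) * C (m₂ * (s - s23)))
        - C (m₃ * (s14 - s13) * (m₂ * (s - s23))) * (C s24 * X ^ 3 - 1))) *
      (X * (C (m₁ * (s14 - s13) * m₄) * (C s24 * X ^ 3 - 1) *
            (2 * C s14 * X ^ 5 + X ^ 2 + 3 * C e₁)
          + C (m₂ * (s24 - s23) * m₄) * (C s14 * X ^ 3 - 1) *
            (2 * C s24 * X ^ 5 + X ^ 2 + 3 * C e₂))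
        - C m₄ * (C s14 * X ^ 3 - 1) * (C s24 * X ^ 3 - 1) *
          (C m₁ * (C (6 * s13 + 2 * s14) * X ^ 3 - 2) +
            C m₂ * (C (6 * s23 + 2 * s24) * X ^ 3 - 2)))
      - X ^ 3 * (C (m₁ * (s14 - s13) * (m₂ * (s - s23))) * (C s24 * X ^ 3 - 1)
          - C (m₂ * (s24 - s23) * (m₁ * (s - s13))) * (C s14 * X ^ 3 - 1)) *
        (C (m₃ * m₄) * (C s14 * X ^ 3 - 1) * (C s24 * X ^ 3 - 1) *
            (C (6 * s13 + 2 * s14) * X ^ 3 - 2)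
          - X * (C (m₃ * m₄ * (s14 - s13)) * (C s24 * X ^ 3 - 1) *
              (2 * C s14 * X ^ 5 + X ^ 2 + 3 * C e₁))
          - X * (C (m₂ * (s - s24) * m₄) *
            ((C s14 * X ^ 3 - 1) * (2 * C s24 * X ^ 5 + X ^ 2 + 3 * C e₂)
              - (C s24 * X ^ 3 - 1) * (2 * C s14 * X ^ 5 + X ^ 2 + 3 * C e₁))))) ?_
  · simp at key
    have h₀ : m₁ + m₂ ≠ 0 := by positivity
    rcases key with (h' | h') | h'
    · exact absurd h' h₂.ne'
    · exact h'
    · rcases h' with h' | h'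
      · exact absurd h' h₄.ne'
      · exact absurd (by linarith) h₀
  · intro x hx
    obtain ⟨y, z, u, v, h⟩ := h x hx
    have hx0 := h.pos
    have hS := h.wing_sum
    have h5 := h.total_sum h₃.ne' h₄.ne'
    have hz : z = y - x ^ 3 * (v - u) := by linear_combination -h.skew
    subst hz
    have e5 : x ^ 3 * (m₁ * (s14 - s13) * (m₂ * (s - s23)) * (s24 * x ^ 3 - 1)
          - m₂ * (s24 - s23) * (m₁ * (s - s13)) * (s14 * x ^ 3 - 1)) * y =
        x ^ 2 * (x * (m₁ * (s14 - s13) * m₄ * (s24 * x ^ 3 - 1) *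
            (2 * s14 * x ^ 5 + x ^ 2 + 3 * e₁)
          + m₂ * (s24 - s23) * m₄ * (s14 * x ^ 3 - 1) *
            (2 * s24 * x ^ 5 + x ^ 2 + 3 * e₂))
        - m₄ * (s14 * x ^ 3 - 1) * (s24 * x ^ 3 - 1) *
          (m₁ * ((6 * s13 + 2 * s14) * x ^ 3 - 2) +
            m₂ * ((6 * s23 + 2 * s24) * x ^ 3 - 2))) := by
      linear_combination m₄ * (s14 * x ^ 3 - 1) * (s24 * x ^ 3 - 1) * h5
        - x ^ 3 * m₁ * (s14 - s13) * (s24 * x ^ 3 - 1) * h.pair13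
        - x ^ 3 * m₂ * (s24 - s23) * (s14 * x ^ 3 - 1) * h.pair23
    have eS : (m₂ * (m₃ * (s - s23) + m₄ * (s - s24)) * (s14 * x ^ 3 - 1) * (s24 * x ^ 3 - 1) +
      x ^ 3 * (m₂ * (s - s24) * ((s14 * x ^ 3 - 1) * (m₁ * (s - s13)) +
          (s24 * x ^ 3 - 1) * (m₂ * (s - s23)))
        - m₃ * (s14 - s13) * (m₂ * (s - s23)) * (s24 * x ^ 3 - 1))) * y =
        x ^ 2 * (m₃ * m₄ * (s14 * x ^ 3 - 1) * (s24 * x ^ 3 - 1) *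
            ((6 * s13 + 2 * s14) * x ^ 3 - 2)
          - x * (m₃ * m₄ * (s14 - s13) * (s24 * x ^ 3 - 1) *
              (2 * s14 * x ^ 5 + x ^ 2 + 3 * e₁))
          - x * (m₂ * (s - s24) * m₄ *
            ((s14 * x ^ 3 - 1) * (2 * s24 * x ^ 5 + x ^ 2 + 3 * e₂)
              - (s24 * x ^ 3 - 1) * (2 * s14 * x ^ 5 + x ^ 2 + 3 * e₁)))) := by
      linear_combination -(s14 * x ^ 3 - 1) * (s24 * x ^ 3 - 1) * hS
        + m₃ * (s14 - s13) * x ^ 3 * (s24 * x ^ 3 - 1) * h.pair13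
        + m₂ * (s - s24) * x ^ 3 * ((s14 * x ^ 3 - 1) * h.pair23
          - (s24 * x ^ 3 - 1) * h.pair13)
    simp only [eval_add, eval_sub, eval_mul, eval_pow, eval_C, eval_X, eval_one, eval_ofNat]
    refine mul_left_cancel₀ (pow_ne_zero 2 hx0.ne') ?_
    generalize x ^ 3 * (m₁ * (s14 - s13) * (m₂ * (s - s23)) * (s24 * x ^ 3 - 1)
          - m₂ * (s24 - s23) * (m₁ * (s - s13)) * (s14 * x ^ 3 - 1)) = c5 at *
    generalize (m₂ * (m₃ * (s - s23) + m₄ * (s - s24)) * (s14 * x ^ 3 - 1) * (s24 * x ^ 3 - 1) +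
      x ^ 3 * (m₂ * (s - s24) * ((s14 * x ^ 3 - 1) * (m₁ * (s - s13)) +
          (s24 * x ^ 3 - 1) * (m₂ * (s - s23)))
        - m₃ * (s14 - s13) * (m₂ * (s - s23)) * (s24 * x ^ 3 - 1))) = cS at *
    linear_combination c5 * eS - cS * e5

theorem wing_ne_zero {T : Set ℝ} (hT : T.Infinite) (hpos : ∀ x ∈ T, 0 < x) (a : ℝ) :
    ∃ x ∈ T, x ^ 2 * (a * x ^ 3 - 2) ≠ 0 := by
  by_contra! H
  have := eval_zero_of_infinite_roots hT (C a * X ^ 3 - 2) (fun x hx => by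
    simpa [(hpos x hx).ne'] using H x hx)
  simp at this

theorem not_infinite {T : Set ℝ} (hT : T.Infinite) (h₁ : 0 < m₁) (h₂ : 0 < m₂) (h₃ : 0 < m₃)
    (h₄ : 0 < m₄) (he : s13 = s23 → s14 = s24 → e₁ = e₂) (h : ∀ x ∈ T, ∃ y z u v,
      HingeRelations m₁ m₂ m₃ m₄ s s13 s14 s23 s24 e₁ e₂ x y z u v) : False := by
  have hpos : ∀ x ∈ T, 0 < x := fun x hx => by
    obtain ⟨y, z, u, v, h⟩ := h x hx
    exact h.pos
  have b₁ := balance hT h₁ h₂ h₃ h₄ h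
  have b₂ : m₃ * (s - s13) + m₄ * (s - s14) = 0 := balance hT h₂ h₁ h₃ h₄ fun x hx => by
    obtain ⟨y, z, u, v, h⟩ := h x hx
    exact ⟨_, _, _, _, h.swap⟩
  have h34 : m₃ * m₄ ≠ 0 := by positivity
  by_cases hs : s13 = s23
  · obtain rfl : s14 = s24 := by
      apply mul_left_cancel₀ h₄.ne'
      linear_combination b₁ - b₂ - m₃ * hs
    subst hs
    obtain rfl := he rfl rfl
    by_cases hA : s - s13 = 0
    · have hA' : s - s14 = 0 := by
        apply mul_left_cancel₀ h₄.ne'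
        linear_combination b₁ - m₃ * hA
      obtain ⟨x, hx, hne⟩ := wing_ne_zero hT hpos (6 * s13 + 2 * s14)
      obtain ⟨y, z, u, v, h⟩ := h x hx
      apply hne
      apply mul_left_cancel₀ h34
      linear_combination h.wing_sum + m₂ * m₃ * y * hA + m₂ * m₄ * z * hA'
        - m₃ * m₄ * x ^ 3 * u * (hA - hA')
    · have := eval_zero_of_infinite_roots hT
        ((C s14 * X ^ 3 - 1) * (C (6 * s13 + 2 * s14) * X ^ 3 - 2)
          - X * (C (s14 - s13) * (2 * C s14 * X ^ 5 + X ^ 2 + 3 * C e₁))) (fun x hx => by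
        obtain ⟨y, z, u, v, h⟩ := h x hx
        have hx0 := h.pos
        have huv : u - v = 0 := by
          have hM : (s - s13) * (m₁ + m₂ + m₃ + m₄) * x ^ 3 ≠ 0 := by
            have : m₁ + m₂ + m₃ + m₄ ≠ 0 := by positivity
            have := hx0.ne'
            positivity
          apply mul_left_cancel₀ hM
          apply mul_left_cancel₀ h₃.ne'
          linear_combination m₃ * (h.pair13 - h.pair23) + m₄ * (h.pair14 - h.pair24)
            + m₃ * (m₁ + m₂) * (s - s13) * h.skew
            + ((m₁ + m₂) * z + m₃ * x ^ 3 * (u - v)) * b₁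
        obtain rfl : u = v := by linarith
        have hy : (s - s13) * y = 0 := by
          have : m₁ + m₂ ≠ 0 := by positivity
          apply mul_left_cancel₀ this
          linear_combination h.pair23 - h.pair13
        have hyz : y = z := by linear_combination h.skew
        subst hyz
        simp only [eval_add, eval_sub, eval_mul, eval_pow, eval_C, eval_X, eval_one, eval_ofNat]
        have h1 : (s14 * x ^ 3 - 1) * u = -(2 * s14 * x ^ 5 + x ^ 2 + 3 * e₁) := by
          apply mul_left_cancel₀ h₄.ne'
          linear_combination h.pair13 + m₂ * hy
        have h2 : (s14 - s13) * x ^ 3 * u + x ^ 2 * ((6 * s13 + 2 * s14) * x ^ 3 - 2) = 0 := by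
          apply mul_left_cancel₀ h34
          linear_combination h.wing_sum + m₂ * y * b₁
        apply mul_left_cancel₀ (pow_ne_zero 2 hx0.ne')
        linear_combination (s14 * x ^ 3 - 1) * h2 - (s14 - s13) * x ^ 3 * h1)
      simp at this
  · have main : ∀ x ∈ T, ∃ u,
        (s14 - s13) * x ^ 3 * u + x ^ 2 * ((6 * s13 + 2 * s14) * x ^ 3 - 2) = 0
        ∧ (s24 - s23) * x ^ 3 * u + x ^ 2 * ((6 * s23 + 2 * s24) * x ^ 3 - 2) = 0 := by
      intro x hx
      obtain ⟨y, z, u, v, h⟩ := h x hx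
      have hx0 := h.pos
      have hyz : y - z = 0 := by
        apply mul_left_cancel₀ (mul_ne_zero h₃.ne' (sub_ne_zero.2 hs))
        linear_combination h.pair12 - z * (b₁ - b₂)
      have huv : v = u := by
        apply mul_left_cancel₀ (pow_ne_zero 3 hx0.ne')
        linear_combination hyz - h.skew
      subst huv
      refine ⟨v, ?_, ?_⟩
      · apply mul_left_cancel₀ h34
        linear_combination h.wing_sum + m₂ * z * b₁ + m₂ * m₃ * (s - s23) * hyz
      · apply mul_left_cancel₀ h34
        linear_combination h.swap.wing_sum - m₁ * z * b₂ - m₁ * m₃ * (s - s13) * hyz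
    have hDD : s24 - s23 = s14 - s13 := by
      have := eval_zero_of_infinite_roots hT
        (C (s24 - s23) * (C (6 * s13 + 2 * s14) * X ^ 3 - 2)
          - C (s14 - s13) * (C (6 * s23 + 2 * s24) * X ^ 3 - 2)) (fun x hx => by
        obtain ⟨u, h1, h2⟩ := main x hx
        simp only [eval_sub, eval_mul, eval_pow, eval_C, eval_X, eval_ofNat]
        apply mul_left_cancel₀ (pow_ne_zero 2 (hpos x hx).ne')
        linear_combination (s24 - s23) * h1 - (s14 - s13) * h2)
      simp only [eval_sub, eval_mul, eval_pow, eval_C, eval_X, eval_ofNat] at this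
      linarith
    obtain ⟨x, hx⟩ := hT.nonempty
    obtain ⟨u, h1, h2⟩ := main x hx
    apply hs
    have hx0 := hpos x hx
    apply mul_left_cancel₀ (pow_ne_zero 5 hx0.ne')
    linear_combination (h1 - h2 + x ^ 3 * u * hDD + 2 * x ^ 5 * hDD) / 8

end HingeRelations

end Relations

section Motion

open Set Topology

theorem infinite_image_of_deriv_ne_zero {I : Set ℝ} (hI : IsOpen I) (hc : I.OrdConnected)
    {R R' : ℝ → ℝ} (hR : ∀ t ∈ I, HasDerivAt R (R' t) t) (hR' : ContinuousOn R' I)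
    (hne : ¬ ∃ c, ∀ t ∈ I, R t = c) : (R '' {t ∈ I | R' t ≠ 0}).Infinite := by
  obtain ⟨t₀, ht₀, h0⟩ : ∃ t ∈ I, R' t ≠ 0 := by
    by_contra! H
    apply hne
    rcases I.eq_empty_or_nonempty with rfl | ⟨a, ha⟩
    · exact ⟨0, by simp⟩
    · refine ⟨R a, fun t ht => ?_⟩
      exact hI.is_const_of_deriv_eq_zero hc.isPreconnected
        (fun s hs => (hR s hs).differentiableAt.differentiableWithinAt)
        (fun s hs => by rw [(hR s hs).deriv]; exact H s hs) ht ha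
  have hopen : IsOpen {t ∈ I | R' t ≠ 0} := hR'.isOpen_inter_preimage hI isOpen_ne
  obtain ⟨ε, hε, hball⟩ := Metric.isOpen_iff.1 hopen t₀ ⟨ht₀, h0⟩
  have hpre : IsPreconnected (R '' Metric.ball t₀ ε) :=
    (convex_ball t₀ ε).isPreconnected.image R fun s hs =>
      (hR s (hball hs).1).continuousAt.continuousWithinAt
  refine (hpre.infinite_of_nontrivial ?_).mono (image_mono hball)
  have h1 : ∀ᶠ s in 𝓝[≠] t₀, R s ≠ R t₀ := (hR t₀ ht₀).eventually_ne h0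
  have h2 : ∀ᶠ s in 𝓝[≠] t₀, s ∈ Metric.ball t₀ ε :=
    nhdsWithin_le_nhds (Metric.ball_mem_nhds t₀ hε)
  obtain ⟨s, hs1, hs2⟩ := (h1.and h2).exists
  exact ⟨R s, mem_image_of_mem R hs2, R t₀, mem_image_of_mem R (Metric.mem_ball_self hε), hs1⟩

section InnerProductSpace

variable {E : Type*} [NormedAddCommGroup E] [InnerProductSpace ℝ E]

theorem inner_velocity_eq_zero {I : Set ℝ} (hI : IsOpen I) {x v : ℝ → E}
    (hx : ∀ t ∈ I, HasDerivAt x (v t) t) {c : ℝ} (hc : ∀ t ∈ I, ‖x t‖ = c) :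
    ∀ t ∈ I, inner ℝ (x t) (v t) = 0 := by
  intro t ht
  have h1 := (hx t ht).norm_sq
  have h2 : HasDerivAt (fun s => ‖x s‖ ^ 2) 0 t :=
    (hasDerivAt_const t (c ^ 2)).congr_of_eventuallyEq <| by
      filter_upwards [hI.mem_nhds ht] with s hs
      rw [hc s hs]
  have := h1.unique h2
  linarith

/-- Differentiating three times the constancy of `‖x‖`. -/
theorem two_mul_inner_velocity_acceleration {I : Set ℝ} (hI : IsOpen I) {x v a : ℝ → E}
    (hx : ∀ t ∈ I, HasDerivAt x (v t) t) (hv : ∀ t ∈ I, HasDerivAt v (a t) t)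
    {c : ℝ} (hc : ∀ t ∈ I, ‖x t‖ = c) {f : ℝ → ℝ} {f' t : ℝ} (ht : t ∈ I)
    (hf : ∀ t ∈ I, inner ℝ (x t) (a t) = f t) (hf' : HasDerivAt f f' t) :
    2 * inner ℝ (v t) (a t) = -f' := by
  have h0 := inner_velocity_eq_zero hI hx hc
  have h1 : ∀ s ∈ I, ‖v s‖ ^ 2 = -f s := by
    intro s hs
    have h2 := (hx s hs).inner ℝ (hv s hs)
    have h3 : HasDerivAt (fun s => inner ℝ (x s) (v s)) (0 : ℝ) s :=
      (hasDerivAt_const s (0 : ℝ)).congr_of_eventuallyEq <| by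
        filter_upwards [hI.mem_nhds hs] with τ hτ
        rw [h0 τ hτ]
    have := h2.unique h3
    rw [hf s hs, real_inner_self_eq_norm_sq] at this
    linarith
  have h2 := (hv t ht).norm_sq
  have h3 : HasDerivAt (fun s => ‖v s‖ ^ 2) (-f') t :=
    hf'.neg.congr_of_eventuallyEq <| by
      filter_upwards [hI.mem_nhds ht] with s hs
      exact h1 s hs
  exact h2.unique h3

theorem inner_sub_sub_eq_dist (a b c : E) :
    inner ℝ (a - b) (c - a) = (dist b c ^ 2 - dist a b ^ 2 - dist a c ^ 2) / 2 := by
  rw [dist_eq_norm, dist_eq_norm, dist_eq_norm]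
  simp only [@norm_sub_sq_real, inner_sub_left, inner_sub_right, real_inner_self_eq_norm_sq,
    real_inner_comm b a]
  ring

end InnerProductSpace

variable {n d : ℕ} {m : Fin n → ℝ} {I : Set ℝ} {X V : ℝ → Fin n → EuclideanSpace ℝ (Fin d)}

theorem acceleration_eq_sum (m : Fin n → ℝ) (x : Fin n → EuclideanSpace ℝ (Fin d)) (i : Fin n) :
    acceleration m x i = ∑ j, (m j / dist (x i) (x j) ^ 3) • (x j - x i) :=
  Finset.sum_erase _ (by simp)

theorem inner_sub_acceleration (m : Fin n → ℝ) (x : Fin n → EuclideanSpace ℝ (Fin d))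
    (i j : Fin n) :
    inner ℝ (x i - x j) (acceleration m x i - acceleration m x j) =
      ∑ l, m l / 2 * ((dist (x j) (x l) ^ 2 - dist (x i) (x j) ^ 2 - dist (x i) (x l) ^ 2) /
          dist (x i) (x l) ^ 3 +
        (dist (x i) (x l) ^ 2 - dist (x i) (x j) ^ 2 - dist (x j) (x l) ^ 2) /
          dist (x j) (x l) ^ 3) := by
  rw [acceleration_eq_sum, acceleration_eq_sum, ← Finset.sum_sub_distrib, inner_sum]
  refine Finset.sum_congr rfl fun l _ => ?_
  have h1 := inner_sub_sub_eq_dist (x i) (x j) (x l)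
  have h2 := inner_sub_sub_eq_dist (x j) (x i) (x l)
  rw [dist_comm (x j) (x i), ← neg_sub, inner_neg_left] at h2
  rw [inner_sub_right, inner_smul_right, inner_smul_right, h1]
  linear_combination (m l / dist (x j) (x l) ^ 3) * h2

namespace IsSolution

theorem hasDerivAt_sub (h : IsSolution m I X V) (i j : Fin n) :
    ∀ t ∈ I, HasDerivAt (fun s => X s i - X s j) (V t i - V t j) t :=
  fun t ht => (h.velocity t ht i).sub (h.velocity t ht j)

theorem hasDerivAt_velocity_sub (h : IsSolution m I X V) (i j : Fin n) :
    ∀ t ∈ I, HasDerivAt (fun s => V s i - V s j)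
      (acceleration m (X t) i - acceleration m (X t) j) t :=
  fun t ht => (h.newton t ht i).sub (h.newton t ht j)

theorem dist_pos (h : IsSolution m I X V) {i j : Fin n} (hij : i ≠ j) {t : ℝ} (ht : t ∈ I) :
    0 < dist (X t i) (X t j) :=
  _root_.dist_pos.2 (h.collisionFree t ht i j hij)

theorem hasDerivAt_dist (h : IsSolution m I X V) {i j : Fin n} (hij : i ≠ j) :
    ∀ t ∈ I, HasDerivAt (fun s => dist (X s i) (X s j))
      (inner ℝ (X t i - X t j) (V t i - V t j) / dist (X t i) (X t j)) t := by
  intro t ht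
  have hpos := h.dist_pos hij ht
  have h1 := (h.hasDerivAt_sub i j t ht).norm_sq.sqrt (by
    rw [← dist_eq_norm]; positivity)
  have h2 : (fun s => √(‖X s i - X s j‖ ^ 2)) = fun s => dist (X s i) (X s j) := by
    funext s
    rw [dist_eq_norm, Real.sqrt_sq (norm_nonneg _)]
  rw [h2, Real.sqrt_sq (norm_nonneg _), ← dist_eq_norm] at h1
  convert h1 using 1
  field_simp

theorem infinite_dist (h : IsSolution m I X V) {i j : Fin n} (hij : i ≠ j)
    (hne : ¬ ConstantDistance I X (i, j)) :
    ((fun t => dist (X t i) (X t j)) ''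
      {t ∈ I | inner ℝ (X t i - X t j) (V t i - V t j) / dist (X t i) (X t j) ≠ 0}).Infinite := by
  refine infinite_image_of_deriv_ne_zero h.isOpen h.ordConnected (h.hasDerivAt_dist hij) ?_ hne
  intro t ht
  have h1 := (h.hasDerivAt_sub i j t ht).continuousAt
  have h2 := (h.hasDerivAt_velocity_sub i j t ht).continuousAt
  have h3 := (h.hasDerivAt_dist hij t ht).continuousAt
  exact ((h1.inner h2).div h3 (h.dist_pos hij ht).ne').continuousWithinAt

theorem inner_velocity (h : IsSolution m I X V) {i j : Fin n} {c : ℝ}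
    (hc : ∀ t ∈ I, dist (X t i) (X t j) = c) :
    ∀ t ∈ I, inner ℝ (V t i - V t j) (X t i - X t j) = 0 := fun t ht => by
  rw [real_inner_comm]
  exact inner_velocity_eq_zero h.isOpen (h.hasDerivAt_sub i j)
    (fun t ht => by rw [← dist_eq_norm]; exact hc t ht) t ht

theorem comp_perm (h : IsSolution m I X V) (e : Equiv.Perm (Fin n)) :
    IsSolution (m ∘ e) I (fun t => X t ∘ e) (fun t => V t ∘ e) where
  isOpen := h.isOpen
  ordConnected := h.ordConnected
  collisionFree t ht i j hij := h.collisionFree t ht _ _ (e.injective.ne hij)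
  velocity t ht i := h.velocity t ht (e i)
  newton t ht i := by
    have := h.newton t ht (e i)
    rw [acceleration_eq_sum, ← Equiv.sum_comp e] at this
    rw [acceleration_eq_sum]
    exact this

end IsSolution

/-- All mutual distances except the one between `k` and `k'` are constant, with values `r`. -/
def IsRigidExcept (I : Set ℝ) (X : ℝ → Fin n → EuclideanSpace ℝ (Fin d)) (k k' : Fin n)
    (r : Fin n → Fin n → ℝ) : Prop :=
  ∀ i j, ¬ (i = k ∧ j = k') → ¬ (i = k' ∧ j = k) → ∀ t ∈ I, dist (X t i) (X t j) = r i j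

theorem IsSolution.axis_equation (h : IsSolution m I X V) {k k' : Fin n}
    {r : Fin n → Fin n → ℝ} (hr : IsRigidExcept I X k k' r) {i j : Fin n} (hik : i ≠ k)
    (hik' : i ≠ k') (hjk : j ≠ k) (hjk' : j ≠ k') {t : ℝ} (ht : t ∈ I) :
    inner ℝ (V t i - V t j) (acceleration m (X t) i - acceleration m (X t) j) = 0 := by
  have hi : ∀ l, ∀ t ∈ I, dist (X t i) (X t l) = r i l := fun l =>
    hr i l (fun H => hik H.1) (fun H => hik' H.1)
  have hj : ∀ l, ∀ t ∈ I, dist (X t j) (X t l) = r j l := fun l =>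
    hr j l (fun H => hjk H.1) (fun H => hjk' H.1)
  have := two_mul_inner_velocity_acceleration h.isOpen (h.hasDerivAt_sub i j)
    (h.hasDerivAt_velocity_sub i j) (c := r i j)
    (fun t ht => by rw [← dist_eq_norm]; exact hi j t ht) ht
    (f := fun _ => ∑ l, m l / 2 * ((r j l ^ 2 - r i j ^ 2 - r i l ^ 2) / r i l ^ 3 +
        (r i l ^ 2 - r i j ^ 2 - r j l ^ 2) / r j l ^ 3))
    (fun t ht => by
      rw [inner_sub_acceleration]
      simp only [hi _ t ht, hj _ t ht]) (hasDerivAt_const _ _)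
  linarith

theorem IsSolution.leg_equation (h : IsSolution m I X V) {k k' : Fin n} (hkk' : k ≠ k')
    {r : Fin n → Fin n → ℝ} (hr : IsRigidExcept I X k k' r) {i : Fin n} (hik : i ≠ k)
    (hik' : i ≠ k') {t R R' : ℝ} (ht : t ∈ I) (hR : dist (X t k) (X t k') = R)
    (hR' : inner ℝ (X t k - X t k') (V t k - V t k') = R * R') :
    4 * R ^ 4 * inner ℝ (V t i - V t k) (acceleration m (X t) i - acceleration m (X t) k) =
      -(m k' * (2 * (1 / r i k' ^ 3) * R ^ 5 + R ^ 2 + 3 * (r i k ^ 2 - r i k' ^ 2)) * R') := by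
  have hi : ∀ l, ∀ t ∈ I, dist (X t i) (X t l) = r i l := fun l =>
    hr i l (fun H => hik H.1) (fun H => hik' H.1)
  have hk : ∀ l ≠ k', ∀ t ∈ I, dist (X t k) (X t l) = r k l := fun l hl =>
    hr k l (fun H => hl H.2) (fun H => hkk' H.1)
  have hRpos : 0 < R := hR ▸ h.dist_pos hkk' ht
  have hD := h.hasDerivAt_dist hkk' t ht
  rw [hR, hR', mul_div_cancel_left₀ _ hRpos.ne'] at hD
  let g : Fin n → ℝ → ℝ := fun l ρ => m l / 2 * ((ρ ^ 2 - r i k ^ 2 - r i l ^ 2) / r i l ^ 3 +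
        (r i l ^ 2 - r i k ^ 2 - ρ ^ 2) / ρ ^ 3)
  have hg : HasDerivAt (fun s => ∑ l, g l (if l = k' then dist (X s k) (X s k') else r k l))
      (∑ l, if l = k' then m k' / 2 * (2 * R / r i k' ^ 3 +
        (1 / R ^ 2 + 3 * (r i k ^ 2 - r i k' ^ 2) / R ^ 4)) * R' else 0) t := by
    refine HasDerivAt.fun_sum fun l _ => ?_
    by_cases hl : l = k'
    · subst hl
      simp only [if_true]
      have hg : HasDerivAt (g l) (m l / 2 * (2 * R / r i l ^ 3 +
          (1 / R ^ 2 + 3 * (r i k ^ 2 - r i l ^ 2) / R ^ 4))) R := by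
        have h2 := hasDerivAt_pow 2 R
        have h3 := hasDerivAt_pow 3 R
        have := ((((h2.sub_const (r i k ^ 2)).sub_const (r i l ^ 2)).div_const (r i l ^ 3)).add
          ((h2.const_sub (r i l ^ 2 - r i k ^ 2)).div h3 (by positivity))).const_mul (m l / 2)
        refine this.congr_deriv ?_
        congr 1
        norm_num
        field_simp
        ring
      rw [← hR] at hg
      exact (hg.comp t hD).congr_deriv (by rw [hR])
    · simp only [hl, if_false]
      exact hasDerivAt_const _ _
  have key := two_mul_inner_velocity_acceleration h.isOpen (h.hasDerivAt_sub i k)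
    (h.hasDerivAt_velocity_sub i k) (c := r i k)
    (fun t ht => by rw [← dist_eq_norm]; exact hi k t ht) ht
    (fun t ht => by
      rw [inner_sub_acceleration]
      refine Finset.sum_congr rfl fun l _ => ?_
      have : dist (X t k) (X t l) = if l = k' then dist (X t k) (X t k') else r k l := by
        split_ifs with hl
        · rw [hl]
        · exact hk l hl t ht
      rw [hi k t ht, hi l t ht, this]) hg
  rw [Finset.sum_ite_eq' Finset.univ k', if_pos (Finset.mem_univ _)] at key
  calc _ = 2 * R ^ 4 * (2 * inner ℝ (V t i - V t k)
        (acceleration m (X t) i - acceleration m (X t) k)) := by ring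
    _ = _ := by
      rw [key]
      field_simp
      ring

end Motion

variable {d : ℕ} {I : Set ℝ}

theorem normalized_leg {μ σ x x' u k y G : ℝ} (S : ℝ) (hx' : x' ≠ 0)
    (hσ : σ * x ^ 3 = 1) (h : 4 * x ^ 4 * (k * y + μ * (S - σ) * u) = -(μ * G * x')) :
    μ * ((S * x ^ 3 - 1) * (4 * x * u / x')) = -(μ * G) - k * (4 * x ^ 4 * y / x') := by
  field_simp
  linear_combination h + μ * 4 * x * u * hσ

theorem three_body_constantDistance {m : Fin 3 → ℝ} (hm : ∀ i, 0 < m i)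
    {X V : ℝ → Fin 3 → EuclideanSpace ℝ (Fin d)} (h : IsSolution m I X V)
    {r : Fin 3 → Fin 3 → ℝ} (hr : IsRigidExcept I X 1 2 r) : ConstantDistance I X (1, 2) := by
  by_contra hne
  refine not_infinite_of_three_body_relations (s₁ := 1 / r 0 1 ^ 3) (s₂ := 1 / r 0 2 ^ 3)
    (e := r 0 1 ^ 2 - r 0 2 ^ 2) (h.infinite_dist (by decide) hne) ?_
  rintro _ ⟨t, ⟨ht, hR'⟩, rfl⟩
  have hRpos := h.dist_pos (i := 1) (j := 2) (by decide) ht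
  have hr' : IsRigidExcept I X 2 1 r := fun i j h1 h2 => hr i j h2 h1
  have c01 := h.inner_velocity (hr 0 1 (by decide) (by decide)) t ht
  have c02 := h.inner_velocity (hr 0 2 (by decide) (by decide)) t ht
  have d01 := hr 0 1 (by decide) (by decide) t ht
  have d02 := hr 0 2 (by decide) (by decide) t ht
  have d10 : dist (X t 1) (X t 0) = r 0 1 := by rw [dist_comm, d01]
  have d20 : dist (X t 2) (X t 0) = r 0 2 := by rw [dist_comm, d02]
  have d21 : dist (X t 2) (X t 1) = dist (X t 1) (X t 2) := dist_comm _ _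
  obtain ⟨R', hRR⟩ : ∃ R', R' = inner ℝ (X t 1 - X t 2) (V t 1 - V t 2) /
    dist (X t 1) (X t 2) := ⟨_, rfl⟩
  rw [← hRR] at hR'
  rw [eq_div_iff hRpos.ne', mul_comm, eq_comm] at hRR
  have hRR' : inner ℝ (X t 2 - X t 1) (V t 2 - V t 1) = dist (X t 1) (X t 2) * R' := by
    rw [← neg_sub, ← neg_sub (V t 1), inner_neg_neg, hRR]
  have e01 := h.leg_equation (i := 0) (by decide) hr (by decide) (by decide) ht rfl hRR
  have e02 := h.leg_equation (i := 0) (by decide) hr' (by decide) (by decide) ht d21 hRR'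
  simp only [acceleration_eq_sum, Fin.sum_univ_three, d01, d02, d10, d20, d21] at e01 e02
  beta_reduce
  generalize dist (X t 1) (X t 2) = R at *
  obtain ⟨σ, hσ⟩ : ∃ σ, σ = 1 / R ^ 3 := ⟨_, rfl⟩
  have hσR : σ * R ^ 3 = 1 := by rw [hσ]; field_simp
  rw [real_inner_comm] at hRR
  simp only [div_eq_mul_one_div (m _), ← hσ] at e01 e02
  generalize 1 / r 0 1 ^ 3 = s1 at *
  generalize 1 / r 0 2 ^ 3 = s2 at *
  have hw : inner ℝ (V t 0 - V t 2) (X t 1 - X t 0) =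
      R * R' - inner ℝ (V t 0 - V t 1) (X t 2 - X t 0) := by
    simp only [inner_sub_left, inner_sub_right] at *
    linear_combination hRR - c01 - c02
  have a01 := normalized_leg s2 (u := inner ℝ (V t 0 - V t 1) (X t 2 - X t 0)) (k := 0) (y := 0)
    hR' hσR (Eq.trans (by
      simp only [inner_sub_left, inner_sub_right, inner_add_right, inner_smul_right] at *
      linear_combination 4 * R ^ 4 * (m 0 * s1 + m 1 * s1 + m 2 * σ) * c01) e01)
  have a02 := normalized_leg s1 (u := R * R' - inner ℝ (V t 0 - V t 1) (X t 2 - X t 0)) (k := 0)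
    (y := 0) hR' hσR (Eq.trans (by
      rw [← hw]
      simp only [inner_sub_left, inner_sub_right, inner_add_right, inner_smul_right] at *
      linear_combination 4 * R ^ 4 * (m 0 * s2 + m 2 * s2 + m 1 * σ) * c02) e02)
  refine ⟨hRpos, 4 * R * inner ℝ (V t 0 - V t 1) (X t 2 - X t 0) / R', ?_, ?_⟩
  · apply mul_left_cancel₀ (hm 2).ne'
    linear_combination a01
  · apply mul_left_cancel₀ (hm 1).ne'
    have : 4 * R * (R * R' - inner ℝ (V t 0 - V t 1) (X t 2 - X t 0)) / R' =
      4 * R ^ 2 - 4 * R * inner ℝ (V t 0 - V t 1) (X t 2 - X t 0) / R' := by field_simp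
    rw [this] at a02
    linear_combination a02

theorem four_body_constantDistance {m : Fin 4 → ℝ} (hm : ∀ i, 0 < m i)
    {X V : ℝ → Fin 4 → EuclideanSpace ℝ (Fin d)} (h : IsSolution m I X V)
    {r : Fin 4 → Fin 4 → ℝ} (hr : IsRigidExcept I X 2 3 r) : ConstantDistance I X (2, 3) := by
  by_contra hne
  have hT := h.infinite_dist (by decide) hne
  obtain ⟨_, t₀, ⟨ht₀, -⟩, -⟩ := hT.nonempty
  refine HingeRelations.not_infinite (s := 1 / r 0 1 ^ 3) (s13 := 1 / r 0 2 ^ 3)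
    (s14 := 1 / r 0 3 ^ 3) (s23 := 1 / r 1 2 ^ 3) (s24 := 1 / r 1 3 ^ 3)
    (e₁ := r 0 2 ^ 2 - r 0 3 ^ 2) (e₂ := r 1 2 ^ 2 - r 1 3 ^ 2)
    hT (hm 0) (hm 1) (hm 2) (hm 3) ?_ ?_
  · have cube : ∀ i j i' j' : Fin 4, dist (X t₀ i) (X t₀ j) = r i j →
        dist (X t₀ i') (X t₀ j') = r i' j' → 1 / r i j ^ 3 = 1 / r i' j' ^ 3 →
        r i j = r i' j' := by
      intro i j i' j' h1 h2 h3
      have p1 : 0 ≤ r i j := h1 ▸ dist_nonneg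
      have p2 : 0 ≤ r i' j' := h2 ▸ dist_nonneg
      rw [one_div, one_div, inv_inj] at h3
      exact (pow_left_inj₀ p1 p2 (by norm_num)).1 h3
    intro h1 h2
    rw [cube 0 2 1 2 (hr 0 2 (by decide) (by decide) t₀ ht₀)
        (hr 1 2 (by decide) (by decide) t₀ ht₀) h1,
      cube 0 3 1 3 (hr 0 3 (by decide) (by decide) t₀ ht₀)
        (hr 1 3 (by decide) (by decide) t₀ ht₀) h2]
  rintro _ ⟨t, ⟨ht, hR'⟩, rfl⟩
  have hRpos := h.dist_pos (i := 2) (j := 3) (by decide) ht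
  have hr' : IsRigidExcept I X 3 2 r := fun i j h1 h2 => hr i j h2 h1
  have c01 := h.inner_velocity (hr 0 1 (by decide) (by decide)) t ht
  have c02 := h.inner_velocity (hr 0 2 (by decide) (by decide)) t ht
  have c03 := h.inner_velocity (hr 0 3 (by decide) (by decide)) t ht
  have c12 := h.inner_velocity (hr 1 2 (by decide) (by decide)) t ht
  have c13 := h.inner_velocity (hr 1 3 (by decide) (by decide)) t ht
  have d01 := hr 0 1 (by decide) (by decide) t ht
  have d02 := hr 0 2 (by decide) (by decide) t ht
  have d03 := hr 0 3 (by decide) (by decide) t ht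
  have d12 := hr 1 2 (by decide) (by decide) t ht
  have d13 := hr 1 3 (by decide) (by decide) t ht
  have d10 : dist (X t 1) (X t 0) = r 0 1 := by rw [dist_comm, d01]
  have d20 : dist (X t 2) (X t 0) = r 0 2 := by rw [dist_comm, d02]
  have d30 : dist (X t 3) (X t 0) = r 0 3 := by rw [dist_comm, d03]
  have d21 : dist (X t 2) (X t 1) = r 1 2 := by rw [dist_comm, d12]
  have d31 : dist (X t 3) (X t 1) = r 1 3 := by rw [dist_comm, d13]
  have d32 : dist (X t 3) (X t 2) = dist (X t 2) (X t 3) := dist_comm _ _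
  obtain ⟨R', hRR⟩ : ∃ R', R' = inner ℝ (X t 2 - X t 3) (V t 2 - V t 3) /
    dist (X t 2) (X t 3) := ⟨_, rfl⟩
  rw [← hRR] at hR'
  rw [eq_div_iff hRpos.ne', mul_comm, eq_comm] at hRR
  have hRR' : inner ℝ (X t 3 - X t 2) (V t 3 - V t 2) = dist (X t 2) (X t 3) * R' := by
    rw [← neg_sub, ← neg_sub (V t 2), inner_neg_neg, hRR]
  have e01 := h.axis_equation (i := 0) (j := 1) hr (by decide) (by decide) (by decide)
    (by decide) ht
  have e02 := h.leg_equation (i := 0) (by decide) hr (by decide) (by decide) ht rfl hRR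
  have e03 := h.leg_equation (i := 0) (by decide) hr' (by decide) (by decide) ht d32 hRR'
  have e12 := h.leg_equation (i := 1) (by decide) hr (by decide) (by decide) ht rfl hRR
  have e13 := h.leg_equation (i := 1) (by decide) hr' (by decide) (by decide) ht d32 hRR'
  simp only [acceleration_eq_sum, Fin.sum_univ_four, d01, d02, d03, d12, d13, d10, d20, d30,
    d21, d31, d32] at e01 e02 e03 e12 e13
  beta_reduce
  generalize dist (X t 2) (X t 3) = R at *
  obtain ⟨σ, hσ⟩ : ∃ σ, σ = 1 / R ^ 3 := ⟨_, rfl⟩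
  have hσR : σ * R ^ 3 = 1 := by rw [hσ]; field_simp
  rw [real_inner_comm] at hRR
  simp only [div_eq_mul_one_div (m _), ← hσ] at e01 e02 e03 e12 e13
  clear hr hr' hRR' d01 d02 d03 d12 d13 d10 d20 d30 d21 d31 d32 hT hne
  generalize 1 / r 0 1 ^ 3 = s at *
  generalize 1 / r 0 2 ^ 3 = s02 at *
  generalize 1 / r 0 3 ^ 3 = s03 at *
  generalize 1 / r 1 2 ^ 3 = s12 at *
  generalize 1 / r 1 3 ^ 3 = s13 at *
  obtain ⟨p, hp⟩ : ∃ p, p = inner ℝ (V t 0 - V t 1) (X t 2 - X t 0) := ⟨_, rfl⟩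
  obtain ⟨q, hq⟩ : ∃ q, q = inner ℝ (V t 0 - V t 1) (X t 3 - X t 0) := ⟨_, rfl⟩
  obtain ⟨u, hu⟩ : ∃ u, u = inner ℝ (V t 0 - V t 2) (X t 3 - X t 0) := ⟨_, rfl⟩
  obtain ⟨v, hv⟩ : ∃ v, v = inner ℝ (V t 1 - V t 2) (X t 3 - X t 1) := ⟨_, rfl⟩
  simp only [inner_sub_left, inner_sub_right, inner_add_right, inner_smul_right] at *
  have huv : v - u = p - q := by
    subst hp hq hu hv
    linear_combination c02 - c12
  have a01 : m 2 * (s02 - s12) * p + m 3 * (s03 - s13) * q = 0 := by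
    subst hp hq hu hv
    linear_combination e01 + ((m 0 + m 1) * s + m 2 * s12 + m 3 * s13) * c01
  have a02 := normalized_leg s03 (u := u) (k := -(m 1 * (s - s12))) (y := p) hR' hσR
    (Eq.trans (by
      rw [hp, hu]
      linear_combination 4 * R ^ 4 * (((m 0 + m 2) * s02 + m 1 * s12 + m 3 * σ) * c02
        - m 1 * (s - s12) * (c12 - c01 - c02))) e02)
  have a03 := normalized_leg s02 (u := R * R' - u) (k := -(m 1 * (s - s13))) (y := q) hR' hσR
    (Eq.trans (by
      rw [hq, hu]
      linear_combination 4 * R ^ 4 * (m 2 * (s02 - σ) * (c02 + c03 - hRR)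
        + ((m 0 + m 3) * s03 + m 1 * s13 + m 2 * σ) * c03 - m 1 * (s - s13) * (c13 - c01 - c03))) e03)
  have a12 := normalized_leg s13 (u := v) (k := m 0 * (s - s02)) (y := p) hR' hσR
    (Eq.trans (by
      rw [hp, hv]
      linear_combination 4 * R ^ 4 * (((m 1 + m 2) * s12 + m 0 * s02 + m 3 * σ) * c12
        + m 0 * (s - s02) * (c12 - c02))) e12)
  have a13 := normalized_leg s12 (u := R * R' - v) (k := m 0 * (s - s03)) (y := q) hR' hσR
    (Eq.trans (by
      rw [hq, hv]
      linear_combination 4 * R ^ 4 * (m 2 * (s12 - σ) * (c12 + c13 - hRR)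
        + ((m 1 + m 3) * s13 + m 0 * s03 + m 2 * σ) * c13 + m 0 * (s - s03) * (c13 - c03))) e13)
  have hsub : ∀ w, 4 * R * (R * R' - w) / R' = 4 * R ^ 2 - 4 * R * w / R' := fun w => by
    field_simp
  rw [hsub] at a03 a13
  refine ⟨4 * R ^ 4 * p / R', 4 * R ^ 4 * q / R', 4 * R * u / R', 4 * R * v / R', hRpos,
    ?_, ?_, ?_, ?_, ?_, ?_⟩
  · linear_combination a02
  · linear_combination a03
  · linear_combination a12
  · linear_combination a13
  · field_simp
    linear_combination -huv
  · field_simp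
    linear_combination 4 * R ^ 4 * a01

theorem unhinged_of_constantDistance {n : ℕ} {a b : Fin n}
    (hperm : ∀ k k' : Fin n, k ≠ k' → ∃ e : Equiv.Perm (Fin n), e a = k ∧ e b = k')
    (H : ∀ m : Fin n → ℝ, (∀ i, 0 < m i) → ∀ (I : Set ℝ)
      (X V : ℝ → Fin n → EuclideanSpace ℝ (Fin d)), IsSolution m I X V →
      ∀ r, IsRigidExcept I X a b r → ConstantDistance I X (a, b)) : Unhinged n d := by
  rintro m hm I X V h ⟨⟨k, k'⟩, hp, hne, hc⟩
  simp only [pairs, Finset.mem_filter, Finset.mem_univ, true_and] at hp hc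
  obtain ⟨e, rfl, rfl⟩ := hperm k k' hp.ne
  have hconst : ∀ i j, ∃ c, ¬ (i = a ∧ j = b) → ¬ (i = b ∧ j = a) →
      ∀ t ∈ I, dist (X t (e i)) (X t (e j)) = c := by
    intro i j
    rcases lt_trichotomy (e i) (e j) with hij | hij | hij
    · by_cases h1 : i = a ∧ j = b
      · exact ⟨0, fun h => absurd h1 h⟩
      · obtain ⟨c, hc⟩ := hc (e i, e j) hij (by simpa using h1)
        exact ⟨c, fun _ _ => hc⟩
    · exact ⟨0, fun _ _ t _ => by rw [hij, dist_self]⟩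
    · by_cases h1 : i = b ∧ j = a
      · exact ⟨0, fun _ h => absurd h1 h⟩
      · obtain ⟨c, hc⟩ := hc (e j, e i) hij (by simpa [and_comm] using h1)
        exact ⟨c, fun _ _ t ht => by rw [dist_comm]; exact hc t ht⟩
  choose r hr using hconst
  exact hne (H (m ∘ e) (fun i => hm (e i)) I (fun t => X t ∘ e) (fun t => V t ∘ e)
    (h.comp_perm e) r hr)

theorem Unhinged.rigidWith {n k : ℕ} (h : Unhinged n d) (hk : (pairs n).card = k + 1) :
    RigidWith n d k := by
  intro m hm I X V hX S hS hcard hc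
  obtain ⟨p, hp⟩ : ∃ p, pairs n \ S = {p} := by
    rw [← Finset.card_eq_one, Finset.card_sdiff_of_subset hS]
    omega
  have hq : ∀ q ∈ pairs n, q ≠ p → ConstantDistance I X q := fun q hq hqp => by
    by_contra hne
    have : q ∈ pairs n \ S := Finset.mem_sdiff.2 ⟨hq, fun hqS => hne (hc q hqS)⟩
    rw [hp, Finset.mem_singleton] at this
    exact hqp this
  have hpp : p ∈ pairs n := (Finset.mem_sdiff.1 (hp ▸ Finset.mem_singleton_self p)).1
  intro q hqn
  by_cases hqp : q = p
  · by_contra hne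
    exact h m hm I X V hX ⟨p, hpp, hqp ▸ hne, hq⟩
  · exact hq q hqn hqp

end NBody

theorem mainTheorem1 (d : ℕ) :
    (NBody.Unhinged 3 d ∧ NBody.RigidWith 3 d 2) ∧
      (NBody.Unhinged 4 d ∧ NBody.RigidWith 4 d 5) := by
  have h3 : NBody.Unhinged 3 d := NBody.unhinged_of_constantDistance (a := 1) (b := 2)
    (by decide) fun m hm I X V h r hr => NBody.three_body_constantDistance hm h hr
  have h4 : NBody.Unhinged 4 d := NBody.unhinged_of_constantDistance (a := 2) (b := 3)
    (by decide) fun m hm I X V h r hr => NBody.four_body_constantDistance hm h hr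
  exact ⟨⟨h3, h3.rigidWith (by decide)⟩, h4, h4.rigidWith (by decide)⟩
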